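/- Let $\mathcal L$ be a first-order vocabulary with equality and $v_1,\dots,v_k$ ($k\ge 0$) distinct variables from an infinite set of variables; models have nonempty domains. A team $X$ of an $\mathcal L$-model $M$ over a set $V$ of variables is a set of assignments $s:V\to M$; for $a\in M$ put $X(a/x)=\{s(a/x)\mid s\in X\}$, a team over $V\cup\{x\}$, and for a team $X$ over $\{v_1,\dots,v_k\}$ put $rel(X)=\{(s(v_1),\dots,s(v_k))\mid s\in X\}\subseteq M^k$. Formulas of $\mathbf{FOT}^{\downarrow}$ are given by $$\phi::=\lambda\mid\neg\delta\mid\phi\wedge\phi\mid\phi\mathbin{\backslash\!\!\vee}\phi\mid\exists^1x\,\phi\mid\forall^1x\,\phi,\qquad \delta::=\lambda\mid\neg\delta\mid\delta\wedge\delta,$$ where $\lambda$ ranges over first-order atomic $\mathcal L$-formulas. For a team $X$ whose domain contains the free variables of the formula, $M\models_X\lambda$ iff every $s\in X$ satisfies $\lambda$ in the usual sense; $M\models_X\neg\delta$ iff $M\not\models_{\{s\}}\delta$ for all $s\in X$; $M\models_X\phi\wedge\psi$ iff $M\models_X\phi$ and $M\models_X\psi$; $M\models_X\phi\mathbin{\backslash\!\!\vee}\psi$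 iff $M\models_X\phi$ or $M\models_X\psi$; and $M\models_X\exists^1x\,\phi$ (respectively $\forall^1x\,\phi$) iff $M\models_{X(a/x)}\phi$ for some (respectively all) $a\in M$. Let $R$ be a fresh $k$-ary relation symbol. An occurrence of $R$ in a first-order sentence is negative if it is in the scope of an odd number of nested negations, where $\alpha\to\beta$ is read as $\neg\alpha\vee\beta$. (1) For every $\mathbf{FOT}^{\downarrow}$-formula $\phi$ with free variables among $v_1,\dots,v_k$ there is a first-order $\mathcal L(R)$-sentence $\gamma_\phi(R)$, in which $R$ occurs only negatively, such that for all $\mathcal L$-models $M$ and all teams $X$ of $M$ over $\{v_1,\dots,v_k\}$, $$M\models_X\phi\iff(M,rel(X))\models\gamma_\phi(R).$$ (2) Conversely, for every first-order $\mathcal L(R)$-sentence $\gamma(R)$ in which $R$ occurs only negatively there is an $\mathbf{FOT}^{\downarrow}$-formula $\phi$ with free variables among $v_1,\dots,v_k$ such that for all $\mathcal L$-models $M$ and all nonempty teams $X$ of $M$ over $\{v_1,\dots,v_k\}$, $M\models_X\phi\iff(M,rel(X))\models\gamma(R)$. (3) Let $\mathcal P$ be a team property, that is, an assignment to each $\mathcal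 L$-model $M$ of a collection $\mathcal P_M$ of subsets of $M^k$. The following are equivalent: - $\emptyset\in\mathcal P_M$ for all $M$; $\mathcal P$ is downward closed ($A\subseteq B\in\mathcal P_M$ implies $A\in\mathcal P_M$); and $\mathcal P$ is first-order, i.e. there is a first-order $\mathcal L(R)$-sentence $\alpha(R)$ with $(M,A)\models\alpha(R)\iff A\in\mathcal P_M$ for all $M$ and all nonempty $A\subseteq M^k$; - there is an $\mathbf{FOT}^{\downarrow}$-formula $\phi$ with free variables among $v_1,\dots,v_k$ such that $\mathcal P_M=\{rel(X)\mid X\text{ a team of }M\text{ over }\{v_1,\dots,v_k\},\ M\models_X\phi\}$ for all $M$. -/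

import Mathlib

open FirstOrder

universe u v w t

namespace TeamLogic

/-! ### Teams -/

/-- An assignment `s : V → M` for a set `V` of (named) variables, changed or extended to
`s(a/x) : V ∪ {x} → M`: it sends `x` to `a` and agrees with `s` on all other variables. -/
noncomputable def update {Var : Type t} {V : Set Var} {M : Type w} (s : V → M) (x : Var) (a : M) :
    ↥(insert x V) → M :=
  open Classical in
  fun y => if h : y.1 = x then a else s ⟨y.1, y.2.resolve_left h⟩

/-- A team of `M` over a set `V` of variables is a set of assignments `V → M`. -/
abbrev Team {Var : Type t} (V : Set Var) (M : Type w) := Set (V → M)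

/-- `X(a/x) = {s(a/x) | s ∈ X}`, a team over `V ∪ {x}`. -/
def Team.update {Var : Type t} {V : Set Var} {M : Type w} (X : Team V M) (x : Var) (a : M) :
    Team (insert x V) M :=
  (fun s => TeamLogic.update s x a) '' X

/-- `rel(X) = {(s(v₁), …, s(vₖ)) | s ∈ X}` for a team `X` over `{v₁, …, vₖ}`. -/
def relOf {Var : Type t} {k : ℕ} (v : Fin k ↪ Var) {M : Type w} (X : Team (Set.range v) M) :
    Set (Fin k → M) :=
  (fun (s : Set.range v → M) (i : Fin k) => s ⟨v i, Set.mem_range_self i⟩) '' X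

/-! ### Syntax -/

/-- First-order atomic formulas with variables in `V`. -/
inductive Atom (L : FirstOrder.Language.{u, v}) {Var : Type t} (V : Set Var) : Type (max u v t)
  | equal (t₁ t₂ : L.Term V) : Atom L V
  | rel {l : ℕ} (S : L.Relations l) (ts : Fin l → L.Term V) : Atom L V

/-- Quantifier-free and disjunction-free first-order formulas
`δ ::= lam | ¬δ | δ ∧ δ` with variables in `V`. -/
inductive QFree (L : FirstOrder.Language.{u, v}) {Var : Type t} (V : Set Var) : Type (max u v t)
  | atom (lam : Atom L V) : QFree L V
  | neg (δ : QFree L V) : QFree L V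
  | and (δ₁ δ₂ : QFree L V) : QFree L V

/-- `FOTd L V` is the type of formulas of the downward closed logic `FOT↓` in the vocabulary `L`
whose free variables are among `V`:
`φ ::= lam | ¬δ | φ ∧ φ | φ ⩖ φ | ∃¹x φ | ∀¹x φ`.
Variables are named, and a quantifier may bind a variable that already is in `V`. -/
inductive FOTd (L : FirstOrder.Language.{u, v}) {Var : Type t} : Set Var → Type (max u v t)
  | atom {V : Set Var} (lam : Atom L V) : FOTd L V
  | neg {V : Set Var} (δ : QFree L V) : FOTd L V
  | and {V : Set Var} (φ ψ : FOTd L V) : FOTd L V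
  | wor {V : Set Var} (φ ψ : FOTd L V) : FOTd L V
  | wex {V : Set Var} (x : Var) (φ : FOTd L (insert x V)) : FOTd L V
  | wall {V : Set Var} (x : Var) (φ : FOTd L (insert x V)) : FOTd L V

/-! ### Team semantics -/

/-- Tarskian truth of an atomic formula under a single assignment. -/
def Atom.Holds {L : FirstOrder.Language.{u, v}} {Var : Type t} {V : Set Var} {M : Type w} [L.Structure M] :
    Atom L V → (V → M) → Prop
  | .equal t₁ t₂, s => t₁.realize s = t₂.realize s
  | .rel S ts, s => FirstOrder.Language.Structure.RelMap S (fun i => (ts i).realize s)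

/-- Team semantics of the first-order formulas `δ`. -/
def QFree.Sat {L : FirstOrder.Language.{u, v}} {Var : Type t} {V : Set Var} {M : Type w} [L.Structure M] :
    QFree L V → Team V M → Prop
  | .atom lam, X => ∀ s ∈ X, lam.Holds s
  | .neg δ, X => ∀ s ∈ X, ¬ δ.Sat {s}
  | .and δ₁ δ₂, X => δ₁.Sat X ∧ δ₂.Sat X

/-- Team semantics of `FOT↓`: `φ.Sat X` is `M ⊨_X φ`. -/
def FOTd.Sat {L : FirstOrder.Language.{u, v}} {Var : Type t} {M : Type w} [L.Structure M] :
    {V : Set Var} → FOTd L V → Team V M → Prop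
  | _, .atom lam, X => ∀ s ∈ X, lam.Holds s
  | _, .neg δ, X => ∀ s ∈ X, ¬ δ.Sat {s}
  | _, .and φ ψ, X => φ.Sat X ∧ ψ.Sat X
  | _, .wor φ ψ, X => φ.Sat X ∨ ψ.Sat X
  | _, .wex x φ, X => ∃ a : M, φ.Sat (X.update x a)
  | _, .wall x φ, X => ∀ a : M, φ.Sat (X.update x a)

/-! ### First-order sentences with an extra relation symbol -/

/-- The relation symbols of the vocabulary `{R}`: only `R`, of arity `k`. -/
inductive ExtraRel (k : ℕ) : ℕ → Type
  | R : ExtraRel k k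

/-- The vocabulary whose only symbol is the `k`-ary relation symbol `R`. -/
def extraLanguage (k : ℕ) : FirstOrder.Language.{0, 0} := ⟨fun _ => Empty, ExtraRel k⟩

/-- The vocabulary `L(R)`, with a fresh `k`-ary relation symbol `R`. -/
abbrev withR (L : FirstOrder.Language.{u, v}) (k : ℕ) : FirstOrder.Language.{u, v} := L.sum (extraLanguage k)

/-- `R` interpreted as `A ⊆ Mᵏ`. -/
@[reducible]
def extraStructure {k : ℕ} {M : Type w} (A : Set (Fin k → M)) : (extraLanguage k).Structure M where
  funMap f := f.elim
  RelMap
    | ExtraRel.R => fun a => a ∈ A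

/-- `(M, A) ⊨ γ`, for an `L(R)`-sentence `γ`. -/
def Models {L : FirstOrder.Language.{u, v}} {k : ℕ} (M : Type w) [L.Structure M] (A : Set (Fin k → M))
    (γ : (withR L k).Sentence) : Prop :=
  letI := extraStructure A
  FirstOrder.Language.Sentence.Realize M γ

/-- `NegWithSign γ p`: if the sign of `γ` itself is `p` (`true` for positive), then every
occurrence of `R` in `γ` is negative. The sign flips in the antecedent of an implication; as
`¬φ` is `φ → ⊥`, it flips under every negation, and it is kept by conjunction, disjunction, `∀`
and `∃`. -/
def NegWithSign {L : FirstOrder.Language.{u, v}} {k : ℕ} {α : Type t} :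
    {n : ℕ} → (withR L k).BoundedFormula α n → Bool → Prop
  | _, .falsum, _ => True
  | _, .equal _ _, _ => True
  | _, .rel (Sum.inl _) _, _ => True
  | _, .rel (Sum.inr _) _, p => p = false
  | _, .imp φ ψ, p => NegWithSign φ (!p) ∧ NegWithSign ψ p
  | _, .all φ, p => NegWithSign φ p

/-- `R` occurs only negatively in the `L(R)`-sentence `γ`. -/
def OnlyNegative {L : FirstOrder.Language.{u, v}} {k : ℕ} (γ : (withR L k).Sentence) : Prop :=
  NegWithSign γ true

/-! ### Team properties -/

/-- A (global) `k`-ary team property: a collection `P_M` of `k`-ary relations on `M`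
for every `L`-model `M`. -/
def TeamProperty (L : FirstOrder.Language.{u, v}) (k : ℕ) :=
  ∀ (M : Type w) [L.Structure M] [Nonempty M], Set (Set (Fin k → M))

namespace TeamProperty

variable {L : FirstOrder.Language.{u, v}} {k : ℕ}

/-- The empty relation belongs to every `P_M`. -/
def ContainsEmpty (P : TeamProperty.{u, v, w} L k) : Prop :=
  ∀ (M : Type w) [L.Structure M] [Nonempty M], ∅ ∈ P M

/-- `A ⊆ B ∈ P_M` implies `A ∈ P_M`. -/
def DownwardClosed (P : TeamProperty.{u, v, w} L k) : Prop :=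
  ∀ (M : Type w) [L.Structure M] [Nonempty M] (A B : Set (Fin k → M)), A ⊆ B → B ∈ P M → A ∈ P M

/-- `P` is first-order: on nonempty relations it is defined by an `L(R)`-sentence. -/
def IsFirstOrder (P : TeamProperty.{u, v, w} L k) : Prop :=
  ∃ α : (withR L k).Sentence, ∀ (M : Type w) [L.Structure M] [Nonempty M] (A : Set (Fin k → M)),
    A.Nonempty → (Models M A α ↔ A ∈ P M)

end TeamProperty

/-- The team property `P^φ_M = {rel(X) | M ⊨_X φ}` defined by `φ(v₁, …, vₖ)`. -/
def FOTd.teamProperty {L : FirstOrder.Language.{u, v}} {Var : Type t} {k : ℕ} (v : Fin k ↪ Var)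
    (φ : FOTd L (Set.range v)) : TeamProperty.{u, v, w} L k :=
  fun M _ _ => {A | ∃ X : Team (Set.range v) M, φ.Sat X ∧ A = relOf v X}

end TeamLogic
open TeamLogic

/-!
Truth of an `FOT↓`-formula in a team `X` depends on `X` only through flat subformulas, which say
that all assignments of the (updated) team satisfy some `δ`. The updates add the same values to all
assignments, so with `R = rel(X)` a flat subformula reads `∀ x, (R x → δ(x, b))`, where `b` are the
quantified values; this is a negative formula, and the remaining connectives are first-order
(`FOTd.exists_onlyNegative`). Conversely, the variables of a first-order formula are simulated by
team variables that are constant on the team. By recursion on the formula and the sign, the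
literals without `R` are flat formulas about constant variables, and `¬ R t` says that no assignment
has `(v₁, …, vₖ) = t` (`exists_team_formula`). Nonemptiness of the team is what makes a flat formula
about constant variables equivalent to its truth for the constants.

The properties defined by formulas are downward closed and contain `∅` by induction on formulas.
For the converse one needs a preservation theorem in the manner of Lyndon: a sentence `α` that is
preserved when `R` shrinks is equivalent to a negative one (`exists_onlyNegative_of_antitone`).
Suppose that `α` is not equivalent to a negative sentence. Then for any finite set of negative
sentences there are a model of `α` and a model of `¬α` such that these sentences are preserved from
the first to the second (`exists_pair_of_not_equiv`). Both models are then made into Henkin models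
over a common set of names. Every name is a witness for an existential formula in one of the two
models, and as negative formulas are closed under `∃`, `∀`, `∧` and `∨`, a choice in either model
can be answered in the other one (`exists_finite_pair`). An ultraproduct of the finite stages
(`exists_pair`) has witnesses for all formulas, and it preserves all negative formulas with names as
parameters. Hence the named elements of both models carry the same `L`-structure, and `R` is larger
in the model of `α` than in the model of `¬α`. By the Tarski–Vaught test both are elementary
substructures, which contradicts the preservation of `α`.
-/

namespace TeamLogic

open FirstOrder.Language FirstOrder.Language.Structure

variable {L : FirstOrder.Language.{u, v}} {k : ℕ}


/-! ### Closure properties of the negative formulas -/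

theorem negWithSign_not {α : Type t} {n : ℕ} {φ : (withR L k).BoundedFormula α n} {p : Bool} :
    NegWithSign φ.not p ↔ NegWithSign φ (!p) := by
  simp [NegWithSign]

theorem NegWithSign.inf {α : Type t} {n : ℕ} {φ ψ : (withR L k).BoundedFormula α n} {p : Bool}
    (hφ : NegWithSign φ p) (hψ : NegWithSign ψ p) : NegWithSign (φ ⊓ ψ) p := by
  simp [Min.min, negWithSign_not, NegWithSign, hφ, hψ]

theorem NegWithSign.sup {α : Type t} {n : ℕ} {φ ψ : (withR L k).BoundedFormula α n} {p : Bool}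
    (hφ : NegWithSign φ p) (hψ : NegWithSign ψ p) : NegWithSign (φ ⊔ ψ) p := by
  simp [max, NegWithSign, hφ, hψ]

theorem NegWithSign.ex {α : Type t} {n : ℕ} {φ : (withR L k).BoundedFormula α (n + 1)} {p : Bool}
    (hφ : NegWithSign φ p) : NegWithSign φ.ex p := by
  simp [NegWithSign, hφ]

theorem negWithSign_foldr_inf {α : Type t} {n : ℕ} {l : List ((withR L k).BoundedFormula α n)}
    {p : Bool} (h : ∀ φ ∈ l, NegWithSign φ p) : NegWithSign (l.foldr (· ⊓ ·) ⊤) p := by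
  induction l with
  | nil => simp [Top.top, negWithSign_not, NegWithSign, Bot.bot]
  | cons φ l ih =>
    exact (h φ (by simp)).inf (ih fun ψ hψ => h ψ (by simp [hψ]))

theorem negWithSign_foldr_sup {α : Type t} {n : ℕ} {l : List ((withR L k).BoundedFormula α n)}
    {p : Bool} (h : ∀ φ ∈ l, NegWithSign φ p) : NegWithSign (l.foldr (· ⊔ ·) ⊥) p := by
  induction l with
  | nil => simp [NegWithSign, Bot.bot]
  | cons φ l ih =>
    exact (h φ (by simp)).sup (ih fun ψ hψ => h ψ (by simp [hψ]))

/-- Substitution of the variables `x_{g 0}, …, x_{g (m - 1)}` for `x₀, …, x_{m - 1}`. -/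
def rename {L : FirstOrder.Language.{u, v}} {α : Type t} :
    {m : ℕ} → L.BoundedFormula α m → {n : ℕ} → (Fin m → Fin n) → L.BoundedFormula α n
  | _, .falsum, _, _ => .falsum
  | _, .equal t₁ t₂, _, g => .equal (t₁.relabel (Sum.map id g)) (t₂.relabel (Sum.map id g))
  | _, .rel S ts, _, g => .rel S fun i => (ts i).relabel (Sum.map id g)
  | _, .imp φ ψ, _, g => .imp (rename φ g) (rename ψ g)
  | _, .all φ, n, g => .all (rename φ (Fin.snoc (Fin.castSucc ∘ g) (Fin.last n)))

theorem realize_rename {L : FirstOrder.Language.{u, v}} {α : Type t} {M : Type w} [L.Structure M]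
    {m n : ℕ} (φ : L.BoundedFormula α m) (g : Fin m → Fin n) (e : α → M) (x : Fin n → M) :
    (rename φ g).Realize e x ↔ φ.Realize e (x ∘ g) := by
  have hterm {m n : ℕ} (g : Fin m → Fin n) (x : Fin n → M) :
      Sum.elim e x ∘ Sum.map id g = Sum.elim e (x ∘ g) := by
    ext (i | i) <;> rfl
  induction φ generalizing n with
  | falsum => rfl
  | equal t₁ t₂ => simp [rename, BoundedFormula.Realize, hterm]
  | rel S ts => simp [rename, BoundedFormula.Realize, hterm]
  | imp φ ψ ih₁ ih₂ => simp [rename, BoundedFormula.Realize, ih₁, ih₂]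
  | all φ ih =>
    simp only [rename, BoundedFormula.Realize, ih]
    refine forall_congr' fun y => ?_
    rw [Fin.comp_snoc, Fin.snoc_last, ← Function.comp_assoc]
    congr! 3
    ext i
    simp

theorem NegWithSign.rename {α : Type t} {m n : ℕ} {φ : (withR L k).BoundedFormula α m} {p : Bool}
    (h : NegWithSign φ p) (g : Fin m → Fin n) : NegWithSign (rename φ g) p := by
  induction φ generalizing n p with
  | falsum => trivial
  | equal t₁ t₂ => trivial
  | rel S ts => cases S <;> exact h
  | imp φ ψ ih₁ ih₂ => exact ⟨ih₁ h.1 g, ih₂ h.2 g⟩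
  | all φ ih => exact ih (p := p) h _

/-! ### Expansions -/

/-- A nonempty `L`-structure together with an interpretation of the fresh relation symbol. -/
structure Expansion (L : FirstOrder.Language.{u, v}) (k : ℕ) where
  /-- The domain. -/
  Carrier : Type w
  /-- The interpretation of the vocabulary `L`. -/
  [str : L.Structure Carrier]
  [ne : Nonempty Carrier]
  /-- The interpretation of `R`. -/
  R : Set (Fin k → Carrier)

attribute [instance] Expansion.str Expansion.ne

instance (𝔐 : Expansion.{u, v, w} L k) : (withR L k).Structure 𝔐.Carrier :=
  letI := extraStructure 𝔐.R
  inferInstance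

/-- `𝔐` satisfies `γ`. -/
abbrev Expansion.Sat (𝔐 : Expansion.{u, v, w} L k) (γ : (withR L k).Sentence) : Prop :=
  Models 𝔐.Carrier 𝔐.R γ

theorem models_iff_realize (𝔐 : Expansion.{u, v, w} L k) (γ : (withR L k).Sentence)
    (e : Empty → 𝔐.Carrier) (x : Fin 0 → 𝔐.Carrier) :
    𝔐.Sat γ ↔ BoundedFormula.Realize γ e x := by
  rw [Subsingleton.elim e default, Subsingleton.elim x default]
  rfl

open Classical in
/-- If no negative sentence is equivalent to `α`, then finitely many negative sentences cannot
prevent the passage from a model of `α` to a model of `¬α`. -/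
theorem exists_pair_of_not_equiv {α : (withR L k).Sentence}
    (hα : ¬ ∃ γ : (withR L k).Sentence, OnlyNegative γ ∧
      ∀ 𝔐 : Expansion.{u, v, w} L k, 𝔐.Sat γ ↔ 𝔐.Sat α)
    (Θ : List (withR L k).Sentence) (hΘ : ∀ θ ∈ Θ, OnlyNegative θ) :
    ∃ 𝔐 𝔑 : Expansion.{u, v, w} L k, 𝔐.Sat α ∧ ¬ 𝔑.Sat α ∧ ∀ θ ∈ Θ, 𝔐.Sat θ → 𝔑.Sat θ := by
  by_contra hno
  push Not at hno
  -- The disjunction of those conjunctions of members of `Θ` that imply `α` would be equivalent to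
  -- `α`.
  refine hα ⟨((Θ.sublists.filter fun Ξ => ∀ 𝔑 : Expansion.{u, v, w} L k,
    (∀ θ ∈ Ξ, 𝔑.Sat θ) → 𝔑.Sat α).map fun Ξ => Ξ.foldr (· ⊓ ·) ⊤).foldr (· ⊔ ·) ⊥, ?_, ?_⟩
  · refine negWithSign_foldr_sup fun φ hφ => ?_
    simp only [List.mem_map, List.mem_filter, List.mem_sublists] at hφ
    obtain ⟨Ξ, ⟨hΞ, -⟩, rfl⟩ := hφ
    exact negWithSign_foldr_inf fun θ hθ => hΘ θ (hΞ.subset hθ)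
  · intro 𝔐
    rw [models_iff_realize 𝔐 _ default default, BoundedFormula.realize_foldr_sup]
    constructor
    · rintro ⟨φ, hφ, h⟩
      simp only [List.mem_map, List.mem_filter, List.mem_sublists, decide_eq_true_eq] at hφ
      obtain ⟨Ξ, ⟨-, hΞ⟩, rfl⟩ := hφ
      rw [BoundedFormula.realize_foldr_inf] at h
      exact hΞ 𝔐 fun θ hθ => (models_iff_realize _ _ _ _).2 (h θ hθ)
    · intro h
      refine ⟨(Θ.filter fun θ => 𝔐.Sat θ).foldr (· ⊓ ·) ⊤, ?_, ?_⟩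
      · simp only [List.mem_map, List.mem_filter, List.mem_sublists, decide_eq_true_eq]
        refine ⟨_, ⟨List.filter_sublist, fun 𝔑 h𝔑 => ?_⟩, rfl⟩
        by_contra hn
        obtain ⟨θ, hθ, h₁, h₂⟩ := hno 𝔐 𝔑 h hn
        exact h₂ (h𝔑 θ (by simp [hθ, h₁]))
      · rw [BoundedFormula.realize_foldr_inf]
        intro θ hθ
        simp only [List.mem_filter, decide_eq_true_eq] at hθ
        exact (models_iff_realize _ _ _ _).1 hθ.2

open Classical in
/-- If the formulas `∃ y, ⋀ Ξ` with `Ξ ⊆ Θ` are preserved from `x` to `y`, then every element on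
the left has an answer on the right for which the members of `Θ` are preserved. -/
theorem exists_forth {M : Type w} {N : Type t} [(withR L k).Structure M] [(withR L k).Structure N]
    {m : ℕ} (Θ : List ((withR L k).BoundedFormula Empty (m + 1))) {x : Fin m → M} {y : Fin m → N}
    (h : ∀ Ξ, List.Sublist Ξ Θ → (Ξ.foldr (· ⊓ ·) ⊤).ex.Realize default x →
      (Ξ.foldr (· ⊓ ·) ⊤).ex.Realize default y) (p : M) :
    ∃ q : N, ∀ θ ∈ Θ, θ.Realize default (Fin.snoc x p) → θ.Realize default (Fin.snoc y q) := by
  simp only [BoundedFormula.realize_ex, BoundedFormula.realize_foldr_inf] at h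
  obtain ⟨q, hq⟩ := h (Θ.filter fun θ => θ.Realize default (Fin.snoc x p)) List.filter_sublist
    ⟨p, fun θ hθ => by simpa using (List.mem_filter.1 hθ).2⟩
  exact ⟨q, fun θ hθ hp => hq θ (by simp [hθ, hp])⟩

open Classical in
/-- If the formulas `∀ y, ⋁ Ξ` with `Ξ ⊆ Θ` are preserved from `x` to `y`, then every element on
the right has an answer on the left for which the members of `Θ` are preserved. -/
theorem exists_back {M : Type w} {N : Type t} [(withR L k).Structure M] [(withR L k).Structure N]
    {m : ℕ} (Θ : List ((withR L k).BoundedFormula Empty (m + 1))) {x : Fin m → M} {y : Fin m → N}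
    (h : ∀ Ξ, List.Sublist Ξ Θ → (Ξ.foldr (· ⊔ ·) ⊥).all.Realize default x →
      (Ξ.foldr (· ⊔ ·) ⊥).all.Realize default y) (q : N) :
    ∃ p : M, ∀ θ ∈ Θ, θ.Realize default (Fin.snoc x p) → θ.Realize default (Fin.snoc y q) := by
  simp only [BoundedFormula.realize_all, BoundedFormula.realize_foldr_sup] at h
  by_contra! hno
  obtain ⟨θ, hθ, hq⟩ := h (Θ.filter fun θ => ¬ θ.Realize default (Fin.snoc y q))
    List.filter_sublist (fun p => by
      obtain ⟨θ, hθ, h₁, h₂⟩ := hno p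
      exact ⟨θ, by simp [hθ, h₂], h₁⟩) q
  exact (by simpa using (List.mem_filter.1 hθ).2 : ¬ _) hq


/-! ### Witnessing constants -/

/-- Names for witnesses of existential formulas: `mk side φ args` names a witness of
`∃ y, φ(args, y)`, on the left of a pair of models if `side = true` and on its right otherwise. The
parameters `args` are names of witnesses themselves. -/
inductive Wit (L : FirstOrder.Language.{u, v}) : Type (max u v)
  | mk (side : Bool) {n : ℕ} (φ : L.BoundedFormula Empty (n + 1)) (args : Fin n → Wit L) : Wit L

/-- Under the interpretation `a` of the names, `c` denotes a witness of its formula if there is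
any, provided that `c` belongs to the given side. -/
def IsWitness {L : FirstOrder.Language.{u, v}} {M : Type w} [L.Structure M] (side : Bool)
    (a : Wit L → M) : Wit L → Prop
  | c@(.mk s (n := n) φ args) => s = side → φ.ex.Realize default (a ∘ args) →
      φ.Realize default (a ∘ (Fin.snoc args c : Fin (n + 1) → Wit L))

/-- `l` lists names without repetition, and each name occurs after all its parameters. -/
inductive Closed {L : FirstOrder.Language.{u, v}} : {m : ℕ} → (Fin m → Wit L) → Prop
  | nil : Closed (Fin.elim0 : Fin 0 → Wit L)
  | snoc {m : ℕ} {l : Fin m → Wit L} (hl : Closed l) (s : Bool) {n : ℕ}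
      (φ : L.BoundedFormula Empty (n + 1)) (args : Fin n → Wit L)
      (hargs : Set.range args ⊆ Set.range l) (hnew : Wit.mk s φ args ∉ Set.range l) :
      Closed (Fin.snoc l (Wit.mk s φ args) : Fin (m + 1) → Wit L)

theorem Closed.args_subset {L : FirstOrder.Language.{u, v}} {m : ℕ} {l : Fin m → Wit L}
    (hl : Closed l) {s : Bool} {n : ℕ} {φ : L.BoundedFormula Empty (n + 1)} {args : Fin n → Wit L}
    (h : Wit.mk s φ args ∈ Set.range l) : Set.range args ⊆ Set.range l := by
  induction hl with
  | nil => simp at h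
  | snoc hl s' φ' args' hargs hnew ih =>
    rw [Fin.range_snoc, Set.mem_insert_iff] at h
    rw [Fin.range_snoc]
    obtain h | h := h
    · cases h
      exact hargs.trans (Set.subset_insert _ _)
    · exact (ih h).trans (Set.subset_insert _ _)

/-- A name can be added to a closed list after its parameters, recursively. -/
theorem Closed.exists_insert {L : FirstOrder.Language.{u, v}} (c : Wit L) {m : ℕ}
    {l : Fin m → Wit L} (hl : Closed l) : ∃ (m' : ℕ) (l' : Fin m' → Wit L), Closed l' ∧
      insert c (Set.range l) ⊆ Set.range l' := by
  induction c generalizing m with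
  | @mk s n φ args ih =>
    have key (T : Finset (Fin n)) : ∃ (m' : ℕ) (l' : Fin m' → Wit L), Closed l' ∧
        args '' T ∪ Set.range l ⊆ Set.range l' := by
      induction T using Finset.induction_on with
      | empty => exact ⟨m, l, hl, by simp⟩
      | insert i T _ ihT =>
        obtain ⟨m₁, l₁, hl₁, h₁⟩ := ihT
        obtain ⟨m₂, l₂, hl₂, h₂⟩ := ih i hl₁
        refine ⟨m₂, l₂, hl₂, ?_⟩
        rw [Finset.coe_insert, Set.image_insert_eq, Set.insert_union]
        exact (Set.insert_subset_insert h₁).trans h₂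
    obtain ⟨m₁, l₁, hl₁, h₁⟩ := key Finset.univ
    rw [Finset.coe_univ, Set.image_univ, Set.union_subset_iff] at h₁
    by_cases hc : Wit.mk s φ args ∈ Set.range l₁
    · exact ⟨m₁, l₁, hl₁, Set.insert_subset hc h₁.2⟩
    · exact ⟨_, _, hl₁.snoc s φ args h₁.1 hc, by
        rw [Fin.range_snoc]; exact Set.insert_subset_insert h₁.2⟩

theorem exists_closed {L : FirstOrder.Language.{u, v}} {S : Set (Wit L)} (hS : S.Finite) :
    ∃ (m : ℕ) (l : Fin m → Wit L), Closed l ∧ S ⊆ Set.range l := by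
  induction S, hS using Set.Finite.induction_on with
  | empty => exact ⟨0, _, .nil, by simp⟩
  | insert _ _ ih =>
    obtain ⟨m, l, hl, h⟩ := ih
    obtain ⟨m', l', hl', h'⟩ := hl.exists_insert _
    exact ⟨m', l', hl', (Set.insert_subset_insert h).trans h'⟩

section Update

variable {L : FirstOrder.Language.{u, v}} {M : Type w}

open Classical in
theorem update_comp_of_range_subset {m n : ℕ} {l : Fin m → Wit L} {c : Wit L}
    (hc : c ∉ Set.range l) {args : Fin n → Wit L} (h : Set.range args ⊆ Set.range l)
    (a : Wit L → M) (p : M) : Function.update a c p ∘ args = a ∘ args := by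
  funext i
  exact Function.update_of_ne (fun hi : args i = c => hc (hi ▸ h ⟨i, rfl⟩)) _ _

open Classical in
theorem IsWitness.update [L.Structure M] {m : ℕ} {l : Fin m → Wit L} (hl : Closed l) {c : Wit L}
    (hc : c ∉ Set.range l) {a : Wit L → M} {p : M} {side : Bool} {d : Wit L}
    (hd : d ∈ Set.range l) (h : IsWitness side a d) :
    IsWitness side (Function.update a c p) d := by
  obtain ⟨s, φ, args⟩ := d
  have hargs := hl.args_subset hd
  simp only [IsWitness] at h ⊢
  rwa [update_comp_of_range_subset hc hargs, update_comp_of_range_subset hc]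
  rw [Fin.range_snoc]
  exact Set.insert_subset hd hargs

open Classical in
theorem isWitness_update_self [L.Structure M] {side s : Bool} {n : ℕ}
    {φ : L.BoundedFormula Empty (n + 1)} {args : Fin n → Wit L} {m : ℕ} {l : Fin m → Wit L}
    (hargs : Set.range args ⊆ Set.range l) (hnew : Wit.mk s φ args ∉ Set.range l) {a : Wit L → M}
    {p : M} (hp : s = side → φ.ex.Realize default (a ∘ args) →
      φ.Realize default (Fin.snoc (a ∘ args) p)) :
    IsWitness side (Function.update a (Wit.mk s φ args) p) (Wit.mk s φ args) := by
  simp only [IsWitness]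
  rwa [Fin.comp_snoc, update_comp_of_range_subset hnew hargs, Function.update_self]

end Update

theorem exists_witness {L : FirstOrder.Language.{u, v}} {M : Type w} [L.Structure M] [Nonempty M]
    {n : ℕ} (φ : L.BoundedFormula Empty (n + 1)) (x : Fin n → M) :
    ∃ p, φ.ex.Realize default x → φ.Realize default (Fin.snoc x p) := by
  simp only [BoundedFormula.realize_ex]
  by_cases h : ∃ p, φ.Realize default (Fin.snoc x p)
  · exact h.imp fun p hp _ => hp
  · exact ⟨Classical.arbitrary M, fun h' => absurd h' h⟩

open Classical in
/-- The finite form of the construction: the names in a closed list are interpreted one after the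
other. A witness is chosen on the side to which the name belongs, and answered on the other side so
that the given negative formulas remain preserved from left to right. -/
theorem exists_finite_pair {α : (withR L k).Sentence}
    (hα : ¬ ∃ γ : (withR L k).Sentence, OnlyNegative γ ∧
      ∀ 𝔐 : Expansion.{u, v, w} L k, 𝔐.Sat γ ↔ 𝔐.Sat α)
    {m : ℕ} {l : Fin m → Wit (withR L k)} (hl : Closed l)
    (Θ : List ((withR L k).BoundedFormula Empty m)) (hΘ : ∀ θ ∈ Θ, NegWithSign θ true) :
    ∃ (𝔐 𝔑 : Expansion.{u, v, w} L k) (a : Wit (withR L k) → 𝔐.Carrier)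
      (b : Wit (withR L k) → 𝔑.Carrier), 𝔐.Sat α ∧ ¬ 𝔑.Sat α ∧
      (∀ c ∈ Set.range l, IsWitness true a c ∧ IsWitness false b c) ∧
      ∀ θ ∈ Θ, θ.Realize default (a ∘ l) → θ.Realize default (b ∘ l) := by
  induction hl with
  | nil =>
    obtain ⟨𝔐, 𝔑, h𝔐, h𝔑, h⟩ := exists_pair_of_not_equiv hα Θ hΘ
    refine ⟨𝔐, 𝔑, fun _ => Classical.arbitrary _, fun _ => Classical.arbitrary _, h𝔐, h𝔑,
      by simp, fun θ hθ hr => ?_⟩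
    exact (models_iff_realize _ _ _ _).1 (h θ hθ ((models_iff_realize _ _ _ _).2 hr))
  | @snoc m l hl s n φ args hargs hnew ih =>
    -- The formulas to preserve before the new name is interpreted quantify over its value.
    obtain ⟨𝔐, 𝔑, a, b, h𝔐, h𝔑, hw, ht⟩ := ih
      (Θ.sublists.map (fun Ξ => (Ξ.foldr (· ⊓ ·) ⊤).ex) ++
        Θ.sublists.map (fun Ξ => (Ξ.foldr (· ⊔ ·) ⊥).all)) (by
      intro θ hθ
      simp only [List.mem_append, List.mem_map, List.mem_sublists] at hθ
      obtain ⟨Ξ, hΞ, rfl⟩ | ⟨Ξ, hΞ, rfl⟩ := hθ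
      · exact NegWithSign.ex (negWithSign_foldr_inf fun θ hθ => hΘ θ (hΞ.subset hθ))
      · exact negWithSign_foldr_sup fun θ hθ => hΘ θ (hΞ.subset hθ))
    have forth := exists_forth Θ (x := a ∘ l) (y := b ∘ l) fun Ξ hΞ => ht _ (by
      simp only [List.mem_append, List.mem_map, List.mem_sublists]; exact .inl ⟨Ξ, hΞ, rfl⟩)
    have back := exists_back Θ (x := a ∘ l) (y := b ∘ l) fun Ξ hΞ => ht _ (by
      simp only [List.mem_append, List.mem_map, List.mem_sublists]; exact .inr ⟨Ξ, hΞ, rfl⟩)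
    obtain ⟨p, q, hp, hq, hpq⟩ : ∃ p q,
        (s = true → φ.ex.Realize default (a ∘ args) →
          φ.Realize default (Fin.snoc (a ∘ args) p)) ∧
        (s = false → φ.ex.Realize default (b ∘ args) →
          φ.Realize default (Fin.snoc (b ∘ args) q)) ∧
        ∀ θ ∈ Θ, θ.Realize default (Fin.snoc (a ∘ l) p) →
          θ.Realize default (Fin.snoc (b ∘ l) q) := by
      cases s with
      | true =>
        obtain ⟨p, hp⟩ := exists_witness φ (a ∘ args)
        obtain ⟨q, hq⟩ := forth p
        exact ⟨p, q, fun _ => hp, by simp, hq⟩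
      | false =>
        obtain ⟨q, hq⟩ := exists_witness φ (b ∘ args)
        obtain ⟨p, hp⟩ := back q
        exact ⟨p, q, by simp, fun _ => hq, hp⟩
    refine ⟨𝔐, 𝔑, Function.update a (.mk s φ args) p, Function.update b (.mk s φ args) q, h𝔐, h𝔑,
      fun c hc => ?_, ?_⟩
    · rw [Fin.range_snoc, Set.mem_insert_iff] at hc
      obtain rfl | hc := hc
      · exact ⟨isWitness_update_self hargs hnew hp, isWitness_update_self hargs hnew hq⟩
      · exact ⟨(hw c hc).1.update hl hnew hc, (hw c hc).2.update hl hnew hc⟩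
    · simpa only [Fin.comp_snoc, update_comp_of_range_subset hnew subset_rfl,
        Function.update_self] using hpq

/-- The ultraproduct of the finite stages: a model of `α` and a model of `¬α`, with all witnesses
named on both sides, such that all negative formulas are preserved from left to right. -/
theorem exists_pair {α : (withR L k).Sentence}
    (hα : ¬ ∃ γ : (withR L k).Sentence, OnlyNegative γ ∧
      ∀ 𝔐 : Expansion.{u, v, max u v w} L k, 𝔐.Sat γ ↔ 𝔐.Sat α) :
    ∃ (M N : Type (max u v w)) (_ : (withR L k).Structure M) (_ : (withR L k).Structure N)
      (a : Wit (withR L k) → M) (b : Wit (withR L k) → N), Sentence.Realize M α ∧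
      ¬ Sentence.Realize N α ∧ (∀ c, IsWitness true a c ∧ IsWitness false b c) ∧
      ∀ {n : ℕ} (θ : (withR L k).BoundedFormula Empty n), NegWithSign θ true →
        ∀ args : Fin n → Wit (withR L k),
          θ.Realize default (a ∘ args) → θ.Realize default (b ∘ args) := by
  classical
  let T := Σ n, {θ : (withR L k).BoundedFormula Empty n // NegWithSign θ true} ×
    (Fin n → Wit (withR L k))
  have hstage (i : Finset (Wit (withR L k)) × Finset T) :
      ∃ (𝔐 𝔑 : Expansion.{u, v, max u v w} L k) (a : Wit (withR L k) → 𝔐.Carrier)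
      (b : Wit (withR L k) → 𝔑.Carrier), 𝔐.Sat α ∧ ¬ 𝔑.Sat α ∧
      (∀ c ∈ i.1, IsWitness true a c ∧ IsWitness false b c) ∧
      ∀ t ∈ i.2, t.2.1.1.Realize default (a ∘ t.2.2) → t.2.1.1.Realize default (b ∘ t.2.2) := by
    obtain ⟨m, l, hl, hsub⟩ := exists_closed (S := ↑i.1 ∪ ⋃ t ∈ i.2, Set.range t.2.2)
      (i.1.finite_toSet.union (i.2.finite_toSet.biUnion fun t _ => Set.finite_range _))
    rw [Set.union_subset_iff, Set.iUnion₂_subset_iff] at hsub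
    have hg (t : i.2) : ∃ g : Fin t.1.1 → Fin m, l ∘ g = t.1.2.2 := by
      choose g hg using fun j => hsub.2 t.1 t.2 ⟨j, rfl⟩
      exact ⟨g, funext hg⟩
    choose g hg using hg
    obtain ⟨𝔐, 𝔑, a, b, h𝔐, h𝔑, hw, ht⟩ := exists_finite_pair hα hl
      (i.2.attach.toList.map fun t => rename t.1.2.1.1 (g t)) (by
        intro θ hθ
        obtain ⟨t, -, rfl⟩ := List.mem_map.1 hθ
        exact t.1.2.1.2.rename _)
    refine ⟨𝔐, 𝔑, a, b, h𝔐, h𝔑, fun c hc => hw c (hsub.1 hc), fun t hti => ?_⟩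
    have := ht _ (List.mem_map.2 ⟨⟨t, hti⟩, by simp, rfl⟩)
    rw [realize_rename, realize_rename, Function.comp_assoc, Function.comp_assoc,
      hg ⟨t, hti⟩] at this
    exact this
  choose 𝔐 𝔑 a b h𝔐 h𝔑 hw ht using hstage
  let 𝒰 : Ultrafilter (Finset (Wit (withR L k)) × Finset T) := Ultrafilter.of Filter.atTop
  have h𝒰 : (𝒰 : Filter (Finset (Wit (withR L k)) × Finset T)) ≤ Filter.atTop :=
    Ultrafilter.of_le _
  -- Łoś's theorem for the formulas with names of witnesses as parameters.
  have los (𝔎 : Finset (Wit (withR L k)) × Finset T → Expansion.{u, v, max u v w} L k)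
      (e : ∀ i, Wit (withR L k) → (𝔎 i).Carrier) {n : ℕ}
      (φ : (withR L k).BoundedFormula Empty n) (args : Fin n → Wit (withR L k)) :
      φ.Realize default ((fun c => ((fun i => e i c : ∀ i, (𝔎 i).Carrier) :
        (𝒰 : Filter _).Product fun i => (𝔎 i).Carrier)) ∘ args) ↔
      ∀ᶠ i in 𝒰, φ.Realize default (e i ∘ args) := by
    have := Ultraproduct.boundedFormula_realize_cast (M := fun i => (𝔎 i).Carrier) (u := 𝒰) φ
      (fun j : Empty => j.elim) (fun j i => e i (args j))
    rw [Subsingleton.elim (fun j : Empty => _) default] at this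
    refine this.trans (Filter.eventually_congr (.of_forall fun i => ?_))
    rw [Subsingleton.elim (fun j : Empty => _) default]
    rfl
  have hwit (𝔎 : Finset (Wit (withR L k)) × Finset T → Expansion.{u, v, max u v w} L k)
      (e : ∀ i, Wit (withR L k) → (𝔎 i).Carrier) (side : Bool) (c : Wit (withR L k))
      (h : ∀ᶠ i in 𝒰, IsWitness side (e i) c) :
      IsWitness side (fun c => ((fun i => e i c : ∀ i, (𝔎 i).Carrier) :
        (𝒰 : Filter _).Product fun i => (𝔎 i).Carrier)) c := by
    obtain ⟨s, φ, args⟩ := c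
    intro hs
    rw [los, los]
    intro hex
    filter_upwards [h, hex] with i h₁ h₂ using h₁ hs h₂
  refine ⟨(𝒰 : Filter _).Product fun i => (𝔐 i).Carrier,
    (𝒰 : Filter _).Product fun i => (𝔑 i).Carrier, inferInstance, inferInstance,
    fun c => (fun i => a i c : ∀ i, (𝔐 i).Carrier), fun c => (fun i => b i c : ∀ i, (𝔑 i).Carrier),
    ?_, ?_, fun c => ?_, fun θ hθ args hr => ?_⟩
  · exact (Ultraproduct.sentence_realize α).2 (.of_forall h𝔐)
  · rw [Ultraproduct.sentence_realize α, ← Ultrafilter.eventually_not]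
    exact .of_forall h𝔑
  · have hc : ∀ᶠ (i : Finset (Wit (withR L k)) × Finset T) in 𝒰, c ∈ i.1 := by
      filter_upwards [h𝒰 (Filter.eventually_ge_atTop ({c}, ∅))] with i hi
      exact hi.1 (Finset.mem_singleton_self c)
    exact ⟨hwit _ _ _ _ (hc.mono fun i hi => (hw i c hi).1),
      hwit _ _ _ _ (hc.mono fun i hi => (hw i c hi).2)⟩
  · refine (los 𝔑 b θ args).2 ?_
    replace hr := (los 𝔐 a θ args).1 hr
    have hc : ∀ᶠ (i : Finset (Wit (withR L k)) × Finset T) in 𝒰, (⟨_, ⟨θ, hθ⟩, args⟩ : T) ∈ i.2 := by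
      filter_upwards [h𝒰 (Filter.eventually_ge_atTop (∅, {⟨_, ⟨θ, hθ⟩, args⟩}))] with i hi
      exact hi.2 (Finset.mem_singleton_self _)
    filter_upwards [hc, hr] with i h₁ h₂ using ht i _ h₁ h₂


/-! ### The preservation theorem for antitone sentences -/

/-- The formula `f(x₀, …, x_{m - 1}) = x_m`. -/
def graphFormula {m : ℕ} (f : L.Functions m) : (withR L k).BoundedFormula Empty (m + 1) :=
  .equal (.func (Sum.inl f) fun i => .var (.inr i.castSucc)) (.var (.inr (Fin.last m)))

theorem realize_graphFormula {U : Type w} [(withR L k).Structure U] {m : ℕ} (f : L.Functions m)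
    (e : Empty → U) (x : Fin m → U) (y : U) :
    (graphFormula (k := k) f).Realize e (Fin.snoc x y) ↔
      y = funMap (L := withR L k) (Sum.inl f) x := by
  change funMap (L := withR L k) (Sum.inl f) (fun i => (Fin.snoc x y : Fin (m + 1) → U) i.castSucc) =
    (Fin.snoc x y : Fin (m + 1) → U) (Fin.last m) ↔ _
  simp only [Fin.snoc_castSucc, Fin.snoc_last, eq_comm]

/-- The name of the value of the function symbol `f` at the given names. -/
def Wit.app {m : ℕ} (f : L.Functions m) (args : Fin m → Wit (withR L k)) : Wit (withR L k) :=
  .mk true (graphFormula f) args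

/-- The named elements form an elementary substructure, by the Tarski–Vaught test. Here the
substructure is given by a type `Q`, whose elements are named by `pick`. -/
theorem models_iff_of_isWitness {U : Type w} [(withR L k).Structure U] {Q : Type w} [L.Structure Q]
    {side : Bool} {a : Wit (withR L k) → U} (ha : ∀ c, IsWitness side a c)
    {pick : Q → Wit (withR L k)} (hinj : Function.Injective (a ∘ pick))
    (hsurj : ∀ c, ∃ q, a (pick q) = a c)
    (hfun : ∀ {n : ℕ} (f : L.Functions n) (x : Fin n → Q),
      a (pick (funMap f x)) = funMap (L := withR L k) (Sum.inl f) (a ∘ pick ∘ x))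
    (hrel : ∀ {n : ℕ} (S : L.Relations n) (x : Fin n → Q),
      RelMap (L := withR L k) (Sum.inl S) (a ∘ pick ∘ x) ↔ RelMap S x)
    (γ : (withR L k).Sentence) :
    Models Q {x | RelMap (L := withR L k) (Sum.inr ExtraRel.R) (a ∘ pick ∘ x)} γ ↔
      Sentence.Realize U γ := by
  let _ := extraStructure {x : Fin k → Q |
    RelMap (L := withR L k) (Sum.inr ExtraRel.R) (a ∘ pick ∘ x)}
  let j : Q ↪[withR L k] U :=
    { toFun := a ∘ pick
      inj' := hinj
      map_fun' := by
        rintro n (f | f) x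
        · exact hfun f x
        · exact f.elim
      map_rel' := by
        rintro n (S | S) x
        · exact hrel S x
        · cases S
          exact Iff.rfl }
  exact (j.toElementaryEmbedding fun n φ x p hp => by
    obtain ⟨q, hq⟩ := hsurj (.mk side φ (pick ∘ x))
    have := ha (.mk side φ (pick ∘ x)) rfl (BoundedFormula.realize_ex.2 ⟨p, hp⟩)
    rw [Fin.comp_snoc, ← hq] at this
    exact ⟨q, this⟩).map_sentence γ

/-- A sentence that is preserved when `R` shrinks is equivalent to one in which `R` occurs only
negatively. -/
theorem exists_onlyNegative_of_antitone {α : (withR L k).Sentence}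
    (hα : ∀ (M : Type (max u v w)) [L.Structure M] [Nonempty M] (A B : Set (Fin k → M)), A ⊆ B →
      Models M B α → Models M A α) :
    ∃ γ : (withR L k).Sentence, OnlyNegative γ ∧
      ∀ (M : Type (max u v w)) [L.Structure M] [Nonempty M] (A : Set (Fin k → M)),
        Models M A γ ↔ Models M A α := by
  by_contra hno
  obtain ⟨M, N, _, _, a, b, hM, hN, hw, ht⟩ := exists_pair.{u, v, w} (α := α) (by
    rintro ⟨γ, hγ, h⟩
    exact hno ⟨γ, hγ, fun M _ _ A => h ⟨M, A⟩⟩)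
  -- Literals in the vocabulary `L` are negative together with their negations.
  have ht_iff {n : ℕ} (θ : (withR L k).BoundedFormula Empty n) (h₁ : NegWithSign θ true)
      (h₂ : NegWithSign θ false) (args : Fin n → Wit (withR L k)) :
      θ.Realize default (a ∘ args) ↔ θ.Realize default (b ∘ args) :=
    ⟨ht θ h₁ args, not_imp_not.1 (ht θ.not (negWithSign_not.2 h₂) args)⟩
  have heq (c d : Wit (withR L k)) : a c = a d ↔ b c = b d := by
    simpa [BoundedFormula.Realize] using
      ht_iff (n := 2) (.equal (.var (.inr 0)) (.var (.inr 1))) trivial trivial ![c, d]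
  have hrel {n : ℕ} (S : L.Relations n) (args : Fin n → Wit (withR L k)) :
      RelMap (L := withR L k) (Sum.inl S) (a ∘ args) ↔
        RelMap (L := withR L k) (Sum.inl S) (b ∘ args) :=
    ht_iff (.rel (Sum.inl S) fun i => .var (.inr i)) trivial trivial args
  have hR (args : Fin k → Wit (withR L k))
      (h : RelMap (L := withR L k) (Sum.inr ExtraRel.R) (b ∘ args)) :
      RelMap (L := withR L k) (Sum.inr ExtraRel.R) (a ∘ args) := by
    by_contra hn
    exact ht (BoundedFormula.not (.rel (Sum.inr ExtraRel.R) fun i => .var (.inr i)))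
      (negWithSign_not.2 rfl) args hn h
  have happ_a {n : ℕ} (f : L.Functions n) (args : Fin n → Wit (withR L k)) :
      a (.app f args) = funMap (L := withR L k) (Sum.inl f) (a ∘ args) := by
    have := (hw (.app f args)).1 rfl (BoundedFormula.realize_ex.2
      ⟨_, (realize_graphFormula f _ _ _).2 rfl⟩)
    rwa [Fin.comp_snoc, realize_graphFormula] at this
  have happ_b {n : ℕ} (f : L.Functions n) (args : Fin n → Wit (withR L k)) :
      b (.app f args) = funMap (L := withR L k) (Sum.inl f) (b ∘ args) := by
    have := ht (graphFormula f) trivial (Fin.snoc args (.app f args))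
    rw [Fin.comp_snoc, Fin.comp_snoc, realize_graphFormula, realize_graphFormula] at this
    exact this (happ_a f args)
  -- Both models have the same `L`-structure on the named elements.
  let pick (q : Set.range a) : Wit (withR L k) := q.2.choose
  have hpick (q : Set.range a) : a (pick q) = q.1 := q.2.choose_spec
  let _ : L.Structure (Set.range a) :=
    { funMap := fun f x => ⟨a (.app f (pick ∘ x)), _, rfl⟩
      RelMap := fun S x => RelMap (L := withR L k) (Sum.inl S) (a ∘ pick ∘ x) }
  have : Nonempty (Set.range a) := ⟨⟨a (.mk true (n := 0) ⊥ Fin.elim0), _, rfl⟩⟩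
  have h_left := models_iff_of_isWitness (fun c => (hw c).1) (pick := pick)
    (fun p q h => Subtype.ext (by simpa [hpick] using h))
    (fun c => ⟨⟨a c, c, rfl⟩, hpick _⟩)
    (fun f x => (hpick _).trans (happ_a f _)) (fun S x => Iff.rfl) α
  have h_right := models_iff_of_isWitness (fun c => (hw c).2) (pick := pick)
    (fun p q h => Subtype.ext (by simpa [hpick] using (heq (pick p) (pick q)).2 h))
    (fun c => ⟨⟨a c, c, rfl⟩, (heq _ _).1 (hpick _)⟩)
    (fun f x => ((heq _ _).1 (hpick _)).trans (happ_b f _)) (fun S x => (hrel S _).symm) α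
  exact hN (h_right.1 (hα _ _ _ (fun x hx => hR _ hx) (h_left.2 hM)))

variable {Var : Type t} {V : Set Var}

/-! ### From team formulas to negative sentences -/

/-- The first-order translation of an atomic formula, with `y ∈ V` read as the variable `τ y`. -/
def Atom.toFO (k : ℕ) {m : ℕ} (τ : V → Fin m) : Atom L V → (withR L k).BoundedFormula Empty m
  | .equal t₁ t₂ => .equal ((LHom.sumInl.onTerm t₁).relabel (Sum.inr ∘ τ))
      ((LHom.sumInl.onTerm t₂).relabel (Sum.inr ∘ τ))
  | .rel S ts => .rel (Sum.inl S) fun i => (LHom.sumInl.onTerm (ts i)).relabel (Sum.inr ∘ τ)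

/-- The first-order translation of a flat formula, with `y ∈ V` read as the variable `τ y`. -/
def QFree.toFO (k : ℕ) {m : ℕ} (τ : V → Fin m) : QFree L V → (withR L k).BoundedFormula Empty m
  | .atom lam => lam.toFO k τ
  | .neg δ => (δ.toFO k τ).not
  | .and δ₁ δ₂ => δ₁.toFO k τ ⊓ δ₂.toFO k τ

/-- The translation of a flat formula contains no occurrence of `R`. -/
theorem QFree.negWithSign_toFO {m : ℕ} (τ : V → Fin m) (δ : QFree L V) (p : Bool) :
    NegWithSign (δ.toFO k τ) p := by
  induction δ generalizing p with
  | atom lam => cases lam <;> trivial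
  | neg δ ih => exact negWithSign_not.2 (ih _)
  | and δ₁ δ₂ ih₁ ih₂ => exact (ih₁ p).inf (ih₂ p)

theorem QFree.realize_toFO (𝔐 : Expansion.{u, v, w} L k) {m : ℕ} (τ : V → Fin m) (δ : QFree L V)
    (e : Empty → 𝔐.Carrier) (x : Fin m → 𝔐.Carrier) :
    (δ.toFO k τ).Realize e x ↔ δ.Sat {x ∘ τ} := by
  let _ := extraStructure 𝔐.R
  have hterm (t : L.Term V) : ((LHom.sumInl.onTerm t : (withR L k).Term V).relabel
      (Sum.inr ∘ τ : V → Empty ⊕ Fin m)).realize (Sum.elim e x) = t.realize (x ∘ τ) := by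
    rw [Term.realize_relabel, ← Function.comp_assoc, Sum.elim_comp_inr]
    exact LHom.realize_onTerm _ _ _
  induction δ with
  | atom lam =>
    simp only [QFree.Sat, Set.mem_singleton_iff, forall_eq]
    cases lam with
    | equal t₁ t₂ => exact iff_of_eq (congrArg₂ _ (hterm t₁) (hterm t₂))
    | rel S ts => exact iff_of_eq (congrArg (RelMap S) (funext fun i => hterm (ts i)))
  | neg δ ih => simp [QFree.Sat, QFree.toFO, ih]
  | and δ₁ δ₂ ih₁ ih₂ => simp [QFree.Sat, QFree.toFO, ih₁, ih₂]

/-- Flat formulas are evaluated assignment by assignment. -/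
theorem QFree.sat_iff_forall {M : Type w} [L.Structure M] (δ : QFree L V) (X : Team V M) :
    δ.Sat X ↔ ∀ s ∈ X, δ.Sat {s} := by
  induction δ with
  | atom lam => simp [QFree.Sat]
  | neg δ ih => simp [QFree.Sat]
  | and δ₁ δ₂ ih₁ ih₂ => simp only [QFree.Sat, ih₁, ih₂, forall₂_and]

/-- The universal quantification of the last `j` variables. -/
def allLast {L : FirstOrder.Language.{u, v}} {n : ℕ} :
    (j : ℕ) → L.BoundedFormula Empty (n + j) → L.BoundedFormula Empty n
  | 0, φ => φ
  | j + 1, φ => allLast j (.all φ)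

theorem realize_allLast {L : FirstOrder.Language.{u, v}} {M : Type w} [L.Structure M] {n j : ℕ}
    (φ : L.BoundedFormula Empty (n + j)) (e : Empty → M) (b : Fin n → M) :
    (allLast j φ).Realize e b ↔ ∀ c : Fin j → M, φ.Realize e (Fin.append b c) := by
  induction j with
  | zero =>
    simp only [allLast, Fin.forall_fin_zero_pi]
    exact iff_of_eq (congrArg _ (funext fun i => (Fin.append_left b _ i).symm))
  | succ j ih =>
    rw [allLast, ih]
    simp only [BoundedFormula.Realize, ← Fin.append_snoc]
    exact ⟨fun h c => by simpa using h (Fin.init c) (c (Fin.last j)), fun h c x => h _⟩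

theorem NegWithSign.allLast {n j : ℕ} {φ : (withR L k).BoundedFormula Empty (n + j)} {p : Bool}
    (h : NegWithSign φ p) : NegWithSign (allLast j φ) p := by
  induction j with
  | zero => exact h
  | succ j ih => exact ih (φ := .all φ) h

/-- The team over `V` that consists of the assignments determined by a tuple in `A` and the fixed
tuple `b`, where `σ` says which coordinate is the value of a variable. -/
def teamOf {M : Type w} {n : ℕ} (σ : V → Fin k ⊕ Fin n) (A : Set (Fin k → M)) (b : Fin n → M) :
    Team V M :=
  (fun a y => Sum.elim a b (σ y)) '' A

open Classical in
/-- The variable `x` is read as a new coordinate of the fixed tuple. -/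
noncomputable def bindVar {n : ℕ} (σ : V → Fin k ⊕ Fin n) (x : Var) :
    ↥(insert x V) → Fin k ⊕ Fin (n + 1) :=
  fun y => if h : y.1 = x then .inr (Fin.last n)
    else Sum.map id Fin.castSucc (σ ⟨y.1, y.2.resolve_left h⟩)

theorem teamOf_update {M : Type w} {n : ℕ} (σ : V → Fin k ⊕ Fin n) (A : Set (Fin k → M))
    (b : Fin n → M) (x : Var) (p : M) :
    (teamOf σ A b).update x p = teamOf (bindVar σ x) A (Fin.snoc b p) := by
  rw [Team.update, teamOf, teamOf, Set.image_image]
  congr! 2 with a - y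
  by_cases h : y.1 = x
  · simp [TeamLogic.update, bindVar, h]
  · simp only [TeamLogic.update, bindVar, h, dite_false]
    cases σ ⟨y.1, y.2.resolve_left h⟩ <;> simp

/-- A flat formula becomes the relativized statement `∀ x, (R x → δ)`. -/
theorem QFree.exists_negative (δ : QFree L V) {n : ℕ} (σ : V → Fin k ⊕ Fin n) :
    ∃ γ : (withR L k).BoundedFormula Empty n, NegWithSign γ true ∧
      ∀ (𝔐 : Expansion.{u, v, w} L k) (b : Fin n → 𝔐.Carrier),
        δ.Sat (teamOf σ 𝔐.R b) ↔ γ.Realize default b := by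
  refine ⟨TeamLogic.allLast k (.imp (.rel (Sum.inr ExtraRel.R) fun i => .var (.inr (Fin.natAdd n i)))
    (δ.toFO k (Sum.elim (Fin.natAdd n) (Fin.castAdd k) ∘ σ))), ?_, fun 𝔐 b => ?_⟩
  · exact NegWithSign.allLast ⟨rfl, δ.negWithSign_toFO _ _⟩
  · rw [realize_allLast, QFree.sat_iff_forall, teamOf, Set.forall_mem_image]
    refine forall_congr' fun c => ?_
    rw [BoundedFormula.realize_imp, QFree.realize_toFO]
    refine imp_congr ?_ (iff_of_eq (congrArg (fun s => δ.Sat {s}) (funext fun y => ?_)))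
    · change _ ↔ (fun i => Fin.append b c (Fin.natAdd n i)) ∈ 𝔐.R
      simp
    · cases h : σ y <;> simp [h]

/-- The induction behind `FOTd.exists_onlyNegative`: the values of the quantified variables are the
free variables of the negative formula. -/
theorem FOTd.exists_negative (φ : FOTd L V) {n : ℕ} (σ : V → Fin k ⊕ Fin n) :
    ∃ γ : (withR L k).BoundedFormula Empty n, NegWithSign γ true ∧
      ∀ (𝔐 : Expansion.{u, v, w} L k) (b : Fin n → 𝔐.Carrier),
        φ.Sat (teamOf σ 𝔐.R b) ↔ γ.Realize default b := by
  induction φ generalizing n with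
  | atom lam => exact (QFree.atom lam).exists_negative σ
  | neg δ => exact (QFree.neg δ).exists_negative σ
  | and φ ψ ih₁ ih₂ =>
    obtain ⟨γ₁, h₁, hγ₁⟩ := ih₁ σ
    obtain ⟨γ₂, h₂, hγ₂⟩ := ih₂ σ
    exact ⟨γ₁ ⊓ γ₂, h₁.inf h₂, fun 𝔐 b => by simp [FOTd.Sat, hγ₁, hγ₂]⟩
  | wor φ ψ ih₁ ih₂ =>
    obtain ⟨γ₁, h₁, hγ₁⟩ := ih₁ σ
    obtain ⟨γ₂, h₂, hγ₂⟩ := ih₂ σ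
    exact ⟨γ₁ ⊔ γ₂, h₁.sup h₂, fun 𝔐 b => by simp [FOTd.Sat, hγ₁, hγ₂]⟩
  | wex x φ ih =>
    obtain ⟨γ, h, hγ⟩ := ih (bindVar σ x)
    exact ⟨γ.ex, h.ex, fun 𝔐 b => by simp [FOTd.Sat, teamOf_update, hγ]⟩
  | wall x φ ih =>
    obtain ⟨γ, h, hγ⟩ := ih (bindVar σ x)
    exact ⟨γ.all, h, fun 𝔐 b => by simp [FOTd.Sat, teamOf_update, hγ]⟩

/-- The first half of the correspondence: every team formula expresses a negative sentence. -/
theorem FOTd.exists_onlyNegative {v : Fin k ↪ Var} (φ : FOTd L (Set.range v)) :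
    ∃ γ : (withR L k).Sentence, OnlyNegative γ ∧
      ∀ (M : Type w) [L.Structure M] [Nonempty M] (X : Team (Set.range v) M),
        φ.Sat X ↔ Models M (relOf v X) γ := by
  obtain ⟨γ, h, hγ⟩ := φ.exists_negative.{u, v, w} (n := 0)
    fun y => Sum.inl ((Equiv.ofInjective v v.injective).symm y)
  refine ⟨γ, h, fun M _ _ X => ?_⟩
  refine Iff.trans ?_ ((hγ ⟨M, relOf v X⟩ default).trans (models_iff_realize _ _ _ _).symm)
  rw [teamOf, relOf, Set.image_image]
  convert Iff.rfl using 2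
  convert Set.image_id X using 2 with s
  funext y
  exact congrArg s ((Equiv.ofInjective v v.injective).apply_symm_apply y)

/-! ### From negative sentences to team formulas -/

/-- The terms of `L(R)` are terms of `L`. -/
def termToL {α : Type*} (ρ : α → V) : (withR L k).Term α → L.Term V
  | .var i => .var (ρ i)
  | .func (Sum.inl f) ts => .func f fun i => termToL ρ (ts i)
  | .func (Sum.inr f) _ => f.elim

theorem realize_termToL (𝔐 : Expansion.{u, v, w} L k) {α : Type*} (ρ : α → V)
    (t : (withR L k).Term α) (s : V → 𝔐.Carrier) :
    (termToL ρ t).realize s = t.realize (s ∘ ρ) := by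
  induction t with
  | var i => rfl
  | func f ts ih =>
    obtain f | f := f
    · simp only [termToL, Term.realize, ih]
      rfl
    · exact f.elim

/-- The variables in `V` are variables in `V ∪ {x}`. -/
def weaken (x : Var) (y : V) : ↥(insert x V) := ⟨y.1, Set.mem_insert_of_mem x y.2⟩

theorem update_comp_weaken {M : Type w} {x : Var} (hx : x ∉ V) (s : V → M) (p : M) :
    update s x p ∘ weaken x = s := by
  funext y
  have : y.1 ≠ x := fun h => hx (h ▸ y.2)
  simp [update, weaken, this]

theorem update_self {M : Type w} (x : Var) (s : V → M) (p : M) :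
    update s x p ⟨x, Set.mem_insert x V⟩ = p := by
  simp [update]

/-- On a nonempty team on whose assignments an atomic formula has constant truth value, the formula
or its negation, according to the sign, is a team formula. -/
theorem exists_literal (lam : Atom L V) (p : Bool) :
    ∃ φ : FOTd L V, ∀ (M : Type w) [L.Structure M] (X : Team V M) (P : Prop), X.Nonempty →
      (∀ s ∈ X, lam.Holds s ↔ P) → (φ.Sat X ↔ (P ↔ p = true)) := by
  cases p with
  | true =>
    refine ⟨.atom lam, fun M _ X P hX h => ?_⟩
    simp only [FOTd.Sat, iff_true]
    exact ⟨fun h' => (h _ hX.some_mem).1 (h' _ hX.some_mem), fun h' s hs => (h s hs).2 h'⟩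
  | false =>
    refine ⟨.neg (.atom lam), fun M _ X P hX h => ?_⟩
    simp only [FOTd.Sat, QFree.Sat, Set.mem_singleton_iff, forall_eq, Bool.false_eq_true, iff_false]
    exact ⟨fun h' hP => h' _ hX.some_mem ((h _ hX.some_mem).2 hP),
      fun h' s hs hl => h' ((h s hs).1 hl)⟩

theorem QFree.sat_foldr_and {M : Type w} [L.Structure M] (l : List (QFree L V)) (δ : QFree L V)
    (X : Team V M) : (l.foldr .and δ).Sat X ↔ (∀ ε ∈ l, ε.Sat X) ∧ δ.Sat X := by
  induction l with
  | nil => simp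
  | cons ε l ih => simp [QFree.Sat, ih, and_assoc]

/-- The variables of `γ` are named by `ρ`, and the tuples in `R` are the values of the variables
`w`. On a nonempty team in which the variables `ρ i` are constant, `γ` or its negation, according
to the sign, is expressed by a team formula. -/
theorem exists_team_formula [Infinite Var] {n : ℕ} (γ : (withR L k).BoundedFormula Empty n)
    (p : Bool) (hγ : NegWithSign γ p) {V : Set Var} (hV : V.Finite) (ρ : Fin n → V) (w : Fin k → V) :
    ∃ φ : FOTd L V, ∀ (𝔐 : Expansion.{u, v, w} L k) (b : Fin n → 𝔐.Carrier) (X : Team V 𝔐.Carrier),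
      X.Nonempty → (∀ s ∈ X, s ∘ ρ = b) → (fun s => s ∘ w) '' X = 𝔐.R →
        (φ.Sat X ↔ (γ.Realize default b ↔ p = true)) := by
  induction γ generalizing p V with
  | falsum =>
    obtain ⟨x, -⟩ := hV.exists_notMem
    let δ : QFree L (insert x V) :=
      .atom (.equal (.var ⟨x, Set.mem_insert x V⟩) (.var ⟨x, Set.mem_insert x V⟩))
    cases p with
    | true =>
      refine ⟨.wex x (.neg δ), fun 𝔐 b X hX _ _ => ?_⟩
      obtain ⟨s, hs⟩ := hX
      simp only [FOTd.Sat, BoundedFormula.Realize, false_iff, not_true, iff_false, not_exists]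
      exact fun a h => h _ ⟨s, hs, rfl⟩ (by simp [δ, QFree.Sat, Atom.Holds])
    | false =>
      refine ⟨.wex x (.neg (.neg δ)), fun 𝔐 b X hX _ _ => ?_⟩
      simp [FOTd.Sat, BoundedFormula.Realize, δ, QFree.Sat, Atom.Holds]
  | equal t₁ t₂ =>
    obtain ⟨φ, hφ⟩ := exists_literal (.equal (termToL (Sum.elim Empty.elim ρ) t₁)
      (termToL (Sum.elim Empty.elim ρ) t₂)) p
    refine ⟨φ, fun 𝔐 b X hX hb _ => hφ _ X _ hX fun s hs => ?_⟩
    simp only [Atom.Holds, realize_termToL, BoundedFormula.Realize, Sum.comp_elim, hb s hs]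
    rw [Subsingleton.elim (s ∘ Empty.elim) default]
  | rel S ts =>
    obtain S | S := S
    · obtain ⟨φ, hφ⟩ := exists_literal
        (.rel S fun i => termToL (Sum.elim Empty.elim ρ) (ts i)) p
      refine ⟨φ, fun 𝔐 b X hX hb _ => hφ _ X _ hX fun s hs => ?_⟩
      simp only [Atom.Holds, realize_termToL, BoundedFormula.Realize, Sum.comp_elim, hb s hs]
      rw [Subsingleton.elim (s ∘ Empty.elim) default]
      rfl
    · cases S
      obtain rfl : p = false := hγ
      obtain ⟨x, hx⟩ := hV.exists_notMem
      -- `¬ R t` says that no assignment of the team has `w = t`. The trivial equation, and the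
      -- quantifier that provides a variable for it, make sense of the conjunction if `k = 0`.
      refine ⟨.wex x (.neg ((List.ofFn fun i => QFree.atom (.equal (.var (weaken x (w i)))
        (termToL (Sum.elim Empty.elim (weaken x ∘ ρ)) (ts i)))).foldr .and
          (.atom (.equal (.var ⟨x, Set.mem_insert x V⟩) (.var ⟨x, Set.mem_insert x V⟩))))),
        fun 𝔐 b X hX hb hR => ?_⟩
      have hmem : (BoundedFormula.rel (L := withR L k) (Sum.inr ExtraRel.R) ts).Realize default b ↔
          (fun i => (ts i).realize (Sum.elim default b)) ∈ 𝔐.R := Iff.rfl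
      have hval (s : V → 𝔐.Carrier) (a : 𝔐.Carrier) (y : V) :
          update s x a (weaken x y) = s y := congrFun (update_comp_weaken hx s a) y
      have hcomp (s : V → 𝔐.Carrier) (hs : s ∈ X) (a : 𝔐.Carrier) :
          update s x a ∘ Sum.elim Empty.elim (weaken x ∘ ρ) = Sum.elim default b := by
        rw [Sum.comp_elim, ← Function.comp_assoc, update_comp_weaken hx, hb s hs]
        congr 1
        exact Subsingleton.elim _ _
      have key (a : 𝔐.Carrier) (s : V → 𝔐.Carrier) (hs : s ∈ X) :
          (∀ i, update s x a (weaken x (w i)) =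
            (ts i).realize (update s x a ∘ Sum.elim Empty.elim (weaken x ∘ ρ))) ↔
          s ∘ w = fun i => (ts i).realize (Sum.elim default b) := by
        simp only [hval, hcomp s hs, funext_iff, Function.comp_apply]
      simp only [FOTd.Sat, Team.update, Set.forall_mem_image, QFree.sat_foldr_and,
        List.forall_mem_ofFn_iff, QFree.Sat, Set.mem_singleton_iff, forall_eq, Atom.Holds,
        Term.realize_var, realize_termToL, and_true, hmem, Bool.false_eq_true, iff_false, ← hR]
      simp +contextual only [key]
      simp
  | imp γ₁ γ₂ ih₁ ih₂ =>
    obtain ⟨φ₁, h₁⟩ := ih₁ (!p) hγ.1 hV ρ w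
    obtain ⟨φ₂, h₂⟩ := ih₂ p hγ.2 hV ρ w
    cases p with
    | true =>
      refine ⟨.wor φ₁ φ₂, fun 𝔐 b X hX hb hR => ?_⟩
      simp [FOTd.Sat, h₁ 𝔐 b X hX hb hR, h₂ 𝔐 b X hX hb hR, imp_iff_not_or]
    | false =>
      refine ⟨.and φ₁ φ₂, fun 𝔐 b X hX hb hR => ?_⟩
      simp [FOTd.Sat, h₁ 𝔐 b X hX hb hR, h₂ 𝔐 b X hX hb hR]
  | all γ ih =>
    obtain ⟨x, hx⟩ := hV.exists_notMem
    obtain ⟨φ, h⟩ := ih p hγ (hV.insert x) (Fin.snoc (weaken x ∘ ρ) ⟨x, Set.mem_insert x V⟩)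
      (weaken x ∘ w)
    have key (𝔐 : Expansion.{u, v, w} L k) b (X : Team V 𝔐.Carrier) (hX : X.Nonempty)
        (hb : ∀ s ∈ X, s ∘ ρ = b) (hR : (fun s => s ∘ w) '' X = 𝔐.R) (a : 𝔐.Carrier) :
        φ.Sat (X.update x a) ↔ (γ.Realize default (Fin.snoc b a) ↔ p = true) := by
      refine h 𝔐 _ _ (hX.image _) ?_ ?_
      · rw [Team.update, Set.forall_mem_image]
        intro s hs
        rw [Fin.comp_snoc, ← Function.comp_assoc, update_comp_weaken hx, update_self, hb s hs]
      · rw [Team.update, Set.image_image, ← hR]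
        simp only [← Function.comp_assoc, update_comp_weaken hx]
    cases p with
    | true =>
      refine ⟨.wall x φ, fun 𝔐 b X hX hb hR => ?_⟩
      simp [FOTd.Sat, key 𝔐 b X hX hb hR]
    | false =>
      refine ⟨.wex x φ, fun 𝔐 b X hX hb hR => ?_⟩
      simp [FOTd.Sat, key 𝔐 b X hX hb hR]

/-- The second half of the correspondence: on nonempty teams, every negative sentence is expressed
by a team formula. -/
theorem exists_team_formula_of_onlyNegative [Infinite Var] (v : Fin k ↪ Var)
    (γ : (withR L k).Sentence) (hγ : OnlyNegative γ) :
    ∃ φ : FOTd L (Set.range v), ∀ (M : Type w) [L.Structure M] [Nonempty M]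
      (X : Team (Set.range v) M), X.Nonempty → (φ.Sat X ↔ Models M (relOf v X) γ) := by
  obtain ⟨φ, hφ⟩ := exists_team_formula.{u, v, w} γ true hγ (Set.finite_range v) Fin.elim0
    fun i => ⟨v i, Set.mem_range_self i⟩
  refine ⟨φ, fun M _ _ X hX => ?_⟩
  have := hφ ⟨M, relOf v X⟩ default X hX (fun s _ => Subsingleton.elim _ _) rfl
  rw [this, iff_true_right rfl]
  exact (models_iff_realize _ _ _ _).symm

/-! ### Team properties defined by formulas -/

theorem QFree.Sat.mono {M : Type w} [L.Structure M] {δ : QFree L V} {X Y : Team V M} (h : X ⊆ Y)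
    (hδ : δ.Sat Y) : δ.Sat X := by
  rw [QFree.sat_iff_forall] at hδ ⊢
  exact fun s hs => hδ s (h hs)

theorem FOTd.Sat.mono {M : Type w} [L.Structure M] {φ : FOTd L V} {X Y : Team V M} (h : X ⊆ Y)
    (hφ : φ.Sat Y) : φ.Sat X := by
  induction φ with
  | atom lam => exact fun s hs => hφ s (h hs)
  | neg δ => exact fun s hs => hφ s (h hs)
  | and φ ψ ih₁ ih₂ => exact ⟨ih₁ h hφ.1, ih₂ h hφ.2⟩
  | wor φ ψ ih₁ ih₂ => exact hφ.imp (ih₁ h) (ih₂ h)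
  | wex x φ ih => exact hφ.imp fun a ha => ih (Set.image_mono h) ha
  | wall x φ ih => exact fun a => ih (Set.image_mono h) (hφ a)

theorem FOTd.sat_empty {M : Type w} [L.Structure M] [Nonempty M] (φ : FOTd L V) :
    φ.Sat (∅ : Team V M) := by
  induction φ with
  | atom lam => exact fun s hs => hs.elim
  | neg δ => exact fun s hs => hs.elim
  | and φ ψ ih₁ ih₂ => exact ⟨ih₁, ih₂⟩
  | wor φ ψ ih₁ ih₂ => exact .inl ih₁
  | wex x φ ih => exact ⟨Classical.arbitrary M, by rwa [Team.update, Set.image_empty]⟩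
  | wall x φ ih => exact fun a => by rwa [Team.update, Set.image_empty]

/-- A team over `{v₁, …, vₖ}` is the same as a `k`-ary relation. -/
theorem relOf_bijective (v : Fin k ↪ Var) (M : Type w) :
    Function.Bijective (relOf v : Team (Set.range v) M → Set (Fin k → M)) := by
  -- `relOf v` is the image under the bijection between assignments and `k`-tuples.
  have h := ((Equiv.ofInjective v v.injective).arrowCongr (Equiv.refl M)).symm.bijective
  exact ⟨h.1.image_injective, h.2.image_surjective⟩

theorem FOTd.relOf_mem_teamProperty {v : Fin k ↪ Var} (φ : FOTd L (Set.range v)) {M : Type w}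
    [L.Structure M] [Nonempty M] (X : Team (Set.range v) M) :
    relOf v X ∈ φ.teamProperty v M ↔ φ.Sat X := by
  refine ⟨?_, fun h => ⟨X, h, rfl⟩⟩
  rintro ⟨Y, hY, h⟩
  rwa [(relOf_bijective v M).1 h]

/-- A first-order property that contains the empty relation is defined by a sentence on the empty
relation as well, namely by `R = ∅ ∨ α`. -/
theorem TeamProperty.IsFirstOrder.exists_sentence {P : TeamProperty.{u, v, w} L k}
    (hP : P.IsFirstOrder) (hempty : P.ContainsEmpty) :
    ∃ α : (withR L k).Sentence, ∀ (M : Type w) [L.Structure M] [Nonempty M] (A : Set (Fin k → M)),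
      Models M A α ↔ A ∈ P M := by
  obtain ⟨α, hα⟩ := hP
  let ε : (withR L k).Sentence := TeamLogic.allLast k
    (BoundedFormula.not (.rel (Sum.inr ExtraRel.R) fun i => .var (.inr (Fin.natAdd 0 i))))
  have hε (𝔐 : Expansion.{u, v, w} L k) : 𝔐.Sat ε ↔ 𝔐.R = ∅ := by
    rw [models_iff_realize 𝔐 ε default default, realize_allLast, Set.eq_empty_iff_forall_notMem]
    refine forall_congr' fun c => ?_
    change (fun i => Fin.append default c (Fin.natAdd 0 i)) ∉ 𝔐.R ↔ _
    simp only [Fin.append_right]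
  have hsup (𝔐 : Expansion.{u, v, w} L k) : 𝔐.Sat (ε ⊔ α) ↔ 𝔐.Sat ε ∨ 𝔐.Sat α :=
    BoundedFormula.realize_sup
  refine ⟨ε ⊔ α, fun M _ _ A => ?_⟩
  refine (hsup ⟨M, A⟩).trans ((or_congr_left (hε ⟨M, A⟩)).trans ?_)
  obtain rfl | hA := A.eq_empty_or_nonempty
  · simp [hempty M]
  · exact (or_iff_right hA.ne_empty).trans (hα M A hA)

theorem FOTd.isFirstOrder_teamProperty {v : Fin k ↪ Var} (φ : FOTd L (Set.range v)) :
    (φ.teamProperty v : TeamProperty.{u, v, w} L k).IsFirstOrder := by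
  obtain ⟨γ, -, hγ⟩ := φ.exists_onlyNegative
  refine ⟨γ, fun M _ _ A _ => ?_⟩
  obtain ⟨X, rfl⟩ := (relOf_bijective v M).2 A
  rw [φ.relOf_mem_teamProperty, hγ]

theorem FOTd.downwardClosed_teamProperty {v : Fin k ↪ Var} (φ : FOTd L (Set.range v)) :
    (φ.teamProperty v : TeamProperty.{u, v, w} L k).DownwardClosed := by
  rintro M _ _ A B hAB ⟨Y, hY, rfl⟩
  obtain ⟨X, hX, rfl⟩ := Set.subset_image_iff.1 hAB
  exact ⟨X, FOTd.Sat.mono hX hY, rfl⟩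

theorem FOTd.containsEmpty_teamProperty {v : Fin k ↪ Var} (φ : FOTd L (Set.range v)) :
    (φ.teamProperty v : TeamProperty.{u, v, w} L k).ContainsEmpty :=
  fun _ _ _ => ⟨∅, φ.sat_empty, (Set.image_empty _).symm⟩

theorem TeamProperty.exists_eq_teamProperty [Infinite Var] (v : Fin k ↪ Var)
    {P : TeamProperty.{u, v, max u v w} L k} (hP : P.IsFirstOrder) (hdown : P.DownwardClosed)
    (hempty : P.ContainsEmpty) : ∃ φ : FOTd L (Set.range v), P = φ.teamProperty v := by
  obtain ⟨α, hα⟩ := hP.exists_sentence hempty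
  obtain ⟨γ, hγ, hγα⟩ := exists_onlyNegative_of_antitone.{u, v, w} (α := α)
    fun M _ _ A B hAB hB => (hα M A).2 (hdown M A B hAB ((hα M B).1 hB))
  obtain ⟨φ, hφ⟩ := exists_team_formula_of_onlyNegative.{u, v, max u v w} v γ hγ
  refine ⟨φ, ?_⟩
  funext M _ _
  ext A
  obtain ⟨X, rfl⟩ := (relOf_bijective v M).2 A
  rw [φ.relOf_mem_teamProperty]
  obtain rfl | hX := X.eq_empty_or_nonempty
  · simpa [relOf, φ.sat_empty] using hempty M
  · rw [hφ M X hX, hγα, hα]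

end TeamLogic

theorem corollary3p6 (L : FirstOrder.Language.{u, v}) (Var : Type t) [Infinite Var]
    (k : ℕ) (v : Fin k ↪ Var) :
    (∀ φ : FOTd L (Set.range v), ∃ γ : (withR L k).Sentence, OnlyNegative γ ∧
      ∀ (M : Type (max u v w)) [L.Structure M] [Nonempty M] (X : Team (Set.range v) M),
        φ.Sat X ↔ Models M (relOf v X) γ) ∧
    (∀ γ : (withR L k).Sentence, OnlyNegative γ → ∃ φ : FOTd L (Set.range v),
      ∀ (M : Type (max u v w)) [L.Structure M] [Nonempty M] (X : Team (Set.range v) M),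
        X.Nonempty → (φ.Sat X ↔ Models M (relOf v X) γ)) ∧
    (∀ P : TeamProperty.{u, v, max u v w} L k,
      (P.IsFirstOrder ∧ P.DownwardClosed ∧ P.ContainsEmpty) ↔
        ∃ φ : FOTd L (Set.range v), P = φ.teamProperty v) := by
  refine ⟨fun φ => φ.exists_onlyNegative, exists_team_formula_of_onlyNegative v,
    fun P => ⟨?_, ?_⟩⟩
  · rintro ⟨hP, hdown, hempty⟩
    exact P.exists_eq_teamProperty.{u, v, w} v hP hdown hempty
  · rintro ⟨φ, rfl⟩
    exact ⟨φ.isFirstOrder_teamProperty, φ.downwardClosed_teamProperty,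
      φ.containsEmpty_teamProperty⟩
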